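/- Let $\mathcal G$ be the group of recursive permutations of $\mathbb N=\{0,1,2,\dots\}$. For $f\in\mathcal G$ let $x\equiv_f y$ mean that $y=f^k(x)$ for some $k\in\mathbb Z$ (the classes of $\equiv_f$ are the cycles of $f$), and let $\mathrm{Perm}$ be the set of all $f\in\mathcal G$ for which $\equiv_f$ is a decidable relation. A decider for the cycles of $f$ is a program which, on input $(x,y)$, halts and correctly answers whether $x\equiv_f y$. Call $f$ and $g$ effectively conjugate if $f=h^{-1}gh$ for some $h\in\mathcal G$. Theorem. There is a $g\in\mathrm{Perm}$ such that the following problem $\mathrm{Conj}(g)$ is recursively unsolvable: given (a program for) $f\in\mathrm{Perm}$ and a decider for its cycles, decide whether $f$ is effectively conjugate to $g$. That is, no partial recursive function, applied to a pair consisting of a program computing some $f\in\mathrm{Perm}$ and a decider for the cycles of $f$, always halts with the correct answer, even if it may behave arbitrarily on all other inputs. Specifically, one may take $$g(x)=\begin{cases}x,& x\equiv 1 \pmod 2,\\ 0,& x=2,\\ x-4,& x\equiv 2 \pmod 4,\ x\neq 2,\\ x+4,& x\equiv 0 \pmod 4,\end{cases}$$ that is, the permutation $g=(\dots,6,2,0,4,8,\dots)$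 consisting of a single infinite cycle on the even numbers and fixing every odd number. -/

import Mathlib

namespace RecPerm

open Nat.Partrec (Code)

/-- The group of recursive permutations of `ℕ`, as a set. -/
def recursivePerms : Set (Equiv.Perm ℕ) :=
  {f | Computable f}

/-- An equivalence relation on `ℕ` is decidable if the predicate "`x` and `y` are equivalent"
in the two variables `x`, `y` is recursive. -/
def DecidableEquivalence (s : Setoid ℕ) : Prop :=
  ComputablePred fun p : ℕ × ℕ => s p.1 p.2

/-- The partition of `ℕ` into the cycles (orbits, fixed points included) of `f`:
`x` and `y` are equivalent iff `y = f ^ k x` for some integer `k`. -/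
def cyclePartition (f : Equiv.Perm ℕ) : Setoid ℕ :=
  Equiv.Perm.SameCycle.setoid f

/-- The recursive permutations whose cycles are exactly the blocks of `s`. -/
def permsOf (s : Setoid ℕ) : Set (Equiv.Perm ℕ) :=
  {f | f ∈ recursivePerms ∧ cyclePartition f = s}

/-- The set `Perm` of recursive permutations with decidable cycles: the union of `permsOf s`
over all decidable equivalence relations `s`. -/
def PermSet : Set (Equiv.Perm ℕ) :=
  ⋃ s ∈ {s : Setoid ℕ | DecidableEquivalence s}, permsOf s

/-- `f` and `g` are effectively conjugate: `f = h⁻¹ g h` for a recursive permutation `h`. -/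
def EffectivelyConjugate (f g : Equiv.Perm ℕ) : Prop :=
  ∃ h ∈ recursivePerms, f = h⁻¹ * g * h

/-- The program `c` computes the permutation `f`. -/
def Computes (c : Code) (f : Equiv.Perm ℕ) : Prop :=
  ∀ x, c.eval x = Part.some (f x)

/-- The program `d` decides the equivalence relation `s`: on the (encoded) pair `(x, y)` it halts
with output `1` if `x` and `y` are equivalent, and with output `0` otherwise. -/
def Decides (d : Code) (s : Setoid ℕ) : Prop :=
  ∀ x y, (s x y → d.eval (Nat.pair x y) = Part.some 1) ∧
    (¬ s x y → d.eval (Nat.pair x y) = Part.some 0)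

/-- The problem `Conj(g)` is recursively solvable: some algorithm, given any program for an
`f ∈ Perm` and any program deciding the cycles of `f`, halts and answers correctly whether `f` is
effectively conjugate to `g`. Nothing is required of the algorithm on other inputs, on which it
may diverge. -/
def ConjSolvable (g : Equiv.Perm ℕ) : Prop :=
  ∃ D : Code × Code →. Bool, Partrec D ∧
    ∀ f ∈ PermSet, ∀ c d : Code, Computes c f → Decides d (cyclePartition f) →
      (EffectivelyConjugate f g → D (c, d) = Part.some true) ∧
      (¬ EffectivelyConjugate f g → D (c, d) = Part.some false)

end RecPerm

/-!
The halting problem reduces to `Conj(g)`. For `P : ℕ → Bool` let `twistedPerm P` move the even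
numbers along one infinite cycle exactly as `g` does and, for every `s` with `P s`, swap `4 s + 1`
and `4 s + 3`, fixing the remaining odd numbers; so `g` is `twistedPerm` of the constant `false`.
The cycle of `x` has the canonical element `cycleRep P x`, which is computable from `P`, so both a
program for `twistedPerm P` and a decider for its cycles are obtained uniformly from a program
for `P` (`exists_computable_code`).

Given a program `c`, take `P s` to say that `c` halts on input `0` within `s` steps (`haltsBy`).
If `c` does not halt, `twistedPerm P` *is* `g`. If `c` halts, `twistedPerm P` has a cycle of
length two, whereas `g` has none, so the two are not conjugate at all. A solution of `Conj(g)`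
would thus decide whether `c` halts on `0`.
-/

namespace RecPerm

open Nat.Partrec (Code)

/-! ### The permutations `twistedPerm P` and their cycles -/

/-- The underlying function of `twistedPerm P`. -/
def twistedFun (P : ℕ → Bool) (x : ℕ) : ℕ :=
  if x % 4 = 0 then x + 4
  else if x = 2 then 0
  else if x % 4 = 2 then x - 4
  else if P (x / 4) = false then x
  else if x % 4 = 1 then x + 2 else x - 2

/-- The inverse of `twistedFun P`. -/
def twistedInv (P : ℕ → Bool) (x : ℕ) : ℕ :=
  if x % 4 = 2 then x + 4
  else if x = 0 then 2
  else if x % 4 = 0 then x - 4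
  else if P (x / 4) = false then x
  else if x % 4 = 1 then x + 2 else x - 2

theorem add_two_div_four {x : ℕ} (h : x % 4 = 1) : (x + 2) / 4 = x / 4 := by omega

theorem sub_two_div_four {x : ℕ} (h : x % 4 = 3) : (x - 2) / 4 = x / 4 := by omega

theorem twistedInv_twistedFun (P : ℕ → Bool) (x : ℕ) : twistedInv P (twistedFun P x) = x := by
  have hx : x % 4 = 0 ∨ x % 4 = 1 ∨ x % 4 = 2 ∨ x % 4 = 3 := by omega
  have h1 := @add_two_div_four x
  have h2 := @sub_two_div_four x
  unfold twistedFun twistedInv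
  cases hP : P (x / 4) <;> rcases hx with h | h | h | h <;> grind

theorem twistedFun_twistedInv (P : ℕ → Bool) (x : ℕ) : twistedFun P (twistedInv P x) = x := by
  have hx : x % 4 = 0 ∨ x % 4 = 1 ∨ x % 4 = 2 ∨ x % 4 = 3 := by omega
  have h1 := @add_two_div_four x
  have h2 := @sub_two_div_four x
  unfold twistedFun twistedInv
  cases hP : P (x / 4) <;> rcases hx with h | h | h | h <;> grind

/-- The permutation with the infinite cycle `(…, 6, 2, 0, 4, 8, …)` on the even numbers and the
transposition of `4 s + 1` and `4 s + 3` for each `s` with `P s`; all other numbers are fixed. -/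
def twistedPerm (P : ℕ → Bool) : Equiv.Perm ℕ where
  toFun := twistedFun P
  invFun := twistedInv P
  left_inv := twistedInv_twistedFun P
  right_inv := twistedFun_twistedInv P

theorem twistedPerm_apply (P : ℕ → Bool) (x : ℕ) : twistedPerm P x = twistedFun P x := rfl

/-- A canonical element of the cycle of `x` under `twistedPerm P`: `0` on the infinite cycle and
the least element on the finite cycles. -/
def cycleRep (P : ℕ → Bool) (x : ℕ) : ℕ :=
  if x % 2 = 0 then 0 else if P (x / 4) = false then x else 4 * (x / 4) + 1

theorem cycleRep_twistedPerm (P : ℕ → Bool) (x : ℕ) :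
    cycleRep P (twistedPerm P x) = cycleRep P x := by
  have hx : x % 4 = 0 ∨ x % 4 = 1 ∨ x % 4 = 2 ∨ x % 4 = 3 := by omega
  have h1 := @add_two_div_four x
  have h2 := @sub_two_div_four x
  rw [twistedPerm_apply]
  unfold twistedFun cycleRep
  cases hP : P (x / 4) <;> rcases hx with h | h | h | h <;> grind

theorem sameCycle_zero_of_even (P : ℕ → Bool) (x : ℕ) (hx : x % 2 = 0) :
    (twistedPerm P).SameCycle x 0 := by
  induction x using Nat.strong_induction_on with
  | _ x ih =>
    rcases Nat.eq_zero_or_pos x with rfl | hpos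
    · rfl
    by_cases h4 : x % 4 = 0
    · have hfx : twistedPerm P (x - 4) = x := by
        rw [twistedPerm_apply, twistedFun]
        grind
      have h := ih (x - 4) (by omega) (by omega)
      rwa [← Equiv.Perm.sameCycle_apply_left, hfx] at h
    · rw [← Equiv.Perm.sameCycle_apply_left]
      have hlt : twistedPerm P x < x ∧ twistedPerm P x % 2 = 0 := by
        rw [twistedPerm_apply, twistedFun]
        grind
      exact ih _ hlt.1 hlt.2

theorem sameCycle_cycleRep (P : ℕ → Bool) (x : ℕ) :
    (twistedPerm P).SameCycle x (cycleRep P x) := by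
  by_cases hx : x % 2 = 0
  · simpa [cycleRep, hx] using sameCycle_zero_of_even P x hx
  cases hP : P (x / 4)
  · simp [cycleRep, hx, hP, Equiv.Perm.SameCycle.refl]
  by_cases h1 : x % 4 = 1
  · have : cycleRep P x = x := by simp only [cycleRep, hx, hP]; grind
    rw [this]
  · have : twistedPerm P x = cycleRep P x := by
      simp only [twistedPerm_apply, twistedFun, cycleRep]; grind
    rw [← this, Equiv.Perm.sameCycle_apply_right]

theorem sameCycle_twistedPerm_iff (P : ℕ → Bool) (x y : ℕ) :
    (twistedPerm P).SameCycle x y ↔ cycleRep P x = cycleRep P y := by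
  constructor
  · rintro ⟨k, rfl⟩
    induction k using Int.induction_on with
    | zero => simp
    | succ k ih =>
      rw [ih, add_comm, zpow_add, zpow_one, Equiv.Perm.mul_apply, cycleRep_twistedPerm]
    | pred k ih =>
      rw [ih, ← cycleRep_twistedPerm P (((twistedPerm P) ^ (-(k : ℤ) - 1)) x),
        ← Equiv.Perm.mul_apply, ← zpow_one_add, add_sub_cancel]
  · intro h
    exact (sameCycle_cycleRep P x).trans (h ▸ (sameCycle_cycleRep P y).symm)

theorem isCycleOn_even_twistedPerm (P : ℕ → Bool) :
    (twistedPerm P).IsCycleOn {x : ℕ | Even x} := by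
  refine ⟨(twistedPerm P).bijOn fun x => ?_, fun x hx y hy => ?_⟩
  · simp only [Set.mem_ofPred_eq, Nat.even_iff, twistedPerm_apply, twistedFun]
    grind
  · exact (sameCycle_zero_of_even P x (Nat.even_iff.1 hx)).trans
      (sameCycle_zero_of_even P y (Nat.even_iff.1 hy)).symm

/-! ### Computability -/

section Computability

variable {α : Type*} [Primcodable α] {P : α → ℕ → Bool}

theorem computable_twistedFun (hP : Computable₂ P) : Computable₂ fun a => twistedFun (P a) := by
  have hx : Computable fun p : α × ℕ => p.2 := Computable.snd
  have hmod : Computable fun p : α × ℕ => p.2 % 4 :=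
    (Primrec.nat_mod.comp Primrec.snd (Primrec.const 4)).to_comp
  have hdiv : Computable fun p : α × ℕ => p.2 / 4 :=
    (Primrec.nat_div.comp Primrec.snd (Primrec.const 4)).to_comp
  have heq {u : α × ℕ → ℕ} (hu : Computable u) (n : ℕ) : Computable fun p => decide (u p = n) :=
    (Primrec.eq (α := ℕ)).decide.to_comp.comp hu (Computable.const n)
  have hadd (n : ℕ) : Computable fun p : α × ℕ => p.2 + n :=
    (Primrec.nat_add.comp Primrec.snd (Primrec.const n)).to_comp
  have hsub (n : ℕ) : Computable fun p : α × ℕ => p.2 - n :=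
    (Primrec.nat_sub.comp Primrec.snd (Primrec.const n)).to_comp
  have hPx : Computable fun p : α × ℕ => P p.1 (p.2 / 4) := hP.comp Computable.fst hdiv
  refine (Computable.cond (heq hmod 0) (hadd 4) <| Computable.cond (heq hx 2) (Computable.const 0) <|
    Computable.cond (heq hmod 2) (hsub 4) <| Computable.cond hPx
      (Computable.cond (heq hmod 1) (hadd 2) (hsub 2)) hx).of_eq fun p => ?_
  unfold twistedFun
  cases h : P p.1 (p.2 / 4) <;> simp [Bool.cond_decide, h]

theorem computable_cycleRep (hP : Computable₂ P) : Computable₂ fun a => cycleRep (P a) := by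
  have hdiv : Computable fun p : α × ℕ => p.2 / 4 :=
    (Primrec.nat_div.comp Primrec.snd (Primrec.const 4)).to_comp
  have heven : Computable fun p : α × ℕ => decide (p.2 % 2 = 0) :=
    ((Primrec.eq (α := ℕ)).decide.comp (Primrec.nat_mod.comp Primrec.snd (Primrec.const 2))
      (Primrec.const 0)).to_comp
  have hrep : Computable fun p : α × ℕ => 4 * (p.2 / 4) + 1 :=
    (Primrec.nat_add.comp (Primrec.nat_mul.comp (Primrec.const 4)
      (Primrec.nat_div.comp Primrec.snd (Primrec.const 4))) (Primrec.const 1)).to_comp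
  have hPx : Computable fun p : α × ℕ => P p.1 (p.2 / 4) := hP.comp Computable.fst hdiv
  refine (Computable.cond heven (Computable.const 0) <|
    Computable.cond hPx hrep Computable.snd).of_eq fun p => ?_
  unfold cycleRep
  cases h : P p.1 (p.2 / 4) <;> simp [Bool.cond_decide, h]

theorem computable_cycleRep_eq (hP : Computable₂ P) :
    Computable₂ fun a (p : ℕ × ℕ) => decide (cycleRep (P a) p.1 = cycleRep (P a) p.2) :=
  (Primrec.eq (α := ℕ)).decide.to_comp.comp
    ((computable_cycleRep hP).comp Computable.fst (Computable.fst.comp Computable.snd))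
    ((computable_cycleRep hP).comp Computable.fst (Computable.snd.comp Computable.snd))

/-- The parameter theorem: programs for the sections of a computable function of two variables
can be found computably. -/
theorem exists_computable_code {F : α → ℕ → ℕ} (hF : Computable₂ F) :
    ∃ T : α → Code, Computable T ∧ ∀ a x, (T a).eval x = Part.some (F a x) := by
  obtain ⟨c, hc⟩ := Code.exists_code.1 (show Nat.Partrec _ from hF)
  refine ⟨fun a => c.curry (Encodable.encode a),
    Code.primrec₂_curry.to_comp.comp (Computable.const c) Computable.encode, fun a x => ?_⟩
  have hdec : Encodable.decode (α := α × ℕ) (Nat.pair (Encodable.encode a) x) = some (a, x) := by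
    rw [← Encodable.encodek (a, x)]
    rfl
  rw [Code.eval_curry, hc]
  change Part.bind (Encodable.decode (α := α × ℕ) (Nat.pair (Encodable.encode a) x) : Part (α × ℕ))
    (fun p => (Part.some (F p.1 p.2)).map Encodable.encode) = _
  rw [hdec]
  simp

end Computability

theorem twistedPerm_mem_permSet {P : ℕ → Bool} (hP : Computable P) : twistedPerm P ∈ PermSet := by
  have hP' : Computable₂ fun _ : Unit => P := hP.comp Computable.snd
  refine Set.mem_biUnion (x := cyclePartition (twistedPerm P)) ?_ ⟨?_, rfl⟩
  · have h : Computable fun p : ℕ × ℕ => decide (cycleRep P p.1 = cycleRep P p.2) :=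
      (computable_cycleRep_eq hP').comp (Computable.const ()) Computable.id
    refine ComputablePred.computable_iff.2 ⟨_, h, funext fun p => propext ?_⟩
    rw [decide_eq_true_iff]
    exact sameCycle_twistedPerm_iff P p.1 p.2
  · exact (computable_twistedFun hP').comp (Computable.const ()) Computable.id

/-! ### The reduction of the halting problem -/

/-- The program `c` halts on input `0` within `s` steps, in the sense of `Code.evaln`. -/
def haltsBy (c : Code) (s : ℕ) : Bool :=
  (Code.evaln s c 0).isSome

theorem computable_haltsBy : Computable₂ haltsBy :=
  (Primrec.option_isSome.comp (Code.primrec_evaln.comp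
    ((Primrec.snd.pair Primrec.fst).pair (Primrec.const 0)))).to_comp

theorem eval_dom_iff_exists_haltsBy (c : Code) : (c.eval 0).Dom ↔ ∃ s, haltsBy c s = true := by
  simp only [Part.dom_iff_mem, haltsBy, Option.isSome_iff_exists, Code.evaln_complete,
    Option.mem_def]
  exact exists_comm

/-- A swapped pair is a cycle of length two, which `twistedPerm fun _ => false` does not have. -/
theorem not_effectivelyConjugate {P : ℕ → Bool} {s : ℕ} (hs : P s = true) :
    ¬ EffectivelyConjugate (twistedPerm P) (twistedPerm fun _ => false) := by
  rintro ⟨h, -, hf⟩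
  have hconj (x : ℕ) : h (twistedPerm P x) = twistedPerm (fun _ => false) (h x) := by
    rw [hf]
    simp
  have h1 : twistedPerm P (4 * s + 1) = 4 * s + 3 := by
    have : (4 * s + 1) / 4 = s := by omega
    rw [twistedPerm_apply, twistedFun, this, hs]
    grind
  have h3 : twistedPerm P (4 * s + 3) = 4 * s + 1 := by
    have : (4 * s + 3) / 4 = s := by omega
    rw [twistedPerm_apply, twistedFun, this, hs]
    grind
  have e1 := hconj (4 * s + 1)
  have e3 := hconj (4 * s + 3)
  rw [h1] at e1
  rw [h3] at e3
  have hne : h (4 * s + 1) ≠ h (4 * s + 3) := fun he => by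
    have := h.injective he
    omega
  generalize h (4 * s + 1) = a at *
  generalize h (4 * s + 3) = b at *
  simp only [twistedPerm_apply, twistedFun] at e1 e3
  grind

theorem not_conjSolvable : ¬ ConjSolvable (twistedPerm fun _ => false) := by
  rintro ⟨D, hD, hsol⟩
  obtain ⟨T, hT, hTeval⟩ := exists_computable_code (computable_twistedFun computable_haltsBy)
  have hdec : Computable₂ fun c n => cond (decide (cycleRep (haltsBy c) (Nat.unpair n).1 =
      cycleRep (haltsBy c) (Nat.unpair n).2)) 1 0 :=
    Computable.cond ((computable_cycleRep_eq computable_haltsBy).comp Computable.fst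
      (Primrec.unpair.to_comp.comp Computable.snd)) (Computable.const 1) (Computable.const 0)
  obtain ⟨E, hE, hEeval⟩ := exists_computable_code hdec
  have hans (c : Code) := hsol _
    (twistedPerm_mem_permSet (computable_haltsBy.comp (Computable.const c) Computable.id))
    (T c) (E c) (hTeval c) fun x y => by
      rw [show (cyclePartition (twistedPerm (haltsBy c))) x y ↔ _ from
        sameCycle_twistedPerm_iff (haltsBy c) x y, hEeval]
      constructor <;> intro h <;> simp [h]
  classical
  -- The answers of `D` are the negations of the answers to the halting problem.
  have hval (c : Code) : D (T c, E c) = Part.some (!decide (c.eval 0).Dom) := by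
    by_cases hc : (c.eval 0).Dom
    · obtain ⟨s, hs⟩ := (eval_dom_iff_exists_haltsBy c).1 hc
      simpa [hc] using (hans c).2 (not_effectivelyConjugate hs)
    · have hP : haltsBy c = fun _ => false := by
        funext s
        by_contra hs
        exact hc ((eval_dom_iff_exists_haltsBy c).2 ⟨s, by simpa using hs⟩)
      have hconj : EffectivelyConjugate (twistedPerm (haltsBy c)) (twistedPerm fun _ => false) :=
        ⟨1, Computable.id, by rw [hP]; simp⟩
      simpa [hc] using (hans c).1 hconj
  have hneg : Computable fun c : Code => !decide (c.eval 0).Dom :=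
    (hD.comp (hT.pair hE)).of_eq hval
  refine ComputablePred.halting_problem 0 (ComputablePred.computable_iff.2
    ⟨_, Primrec.not.to_comp.comp hneg, funext fun c => ?_⟩)
  simp

end RecPerm

theorem mainTheorem6 :
    ∃ g : Equiv.Perm ℕ,
      ((∀ k : ℕ, g (2 * k + 1) = 2 * k + 1) ∧
        g 2 = 0 ∧
        (∀ k : ℕ, g (4 * k + 6) = 4 * k + 2) ∧
        (∀ k : ℕ, g (4 * k) = 4 * k + 4)) ∧
      g.IsCycleOn {x : ℕ | Even x} ∧
      g ∈ RecPerm.PermSet ∧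
      ¬ RecPerm.ConjSolvable g := by
  refine ⟨RecPerm.twistedPerm fun _ => false, ⟨fun k => ?_, rfl, fun k => ?_, fun k => ?_⟩,
    RecPerm.isCycleOn_even_twistedPerm _,
    RecPerm.twistedPerm_mem_permSet (Computable.const false), RecPerm.not_conjSolvable⟩ <;>
  · rw [RecPerm.twistedPerm_apply, RecPerm.twistedFun]
    grind
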